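/- Let $d\ge 1$ be an integer and let $0<s<1$ with $d>2s$. For $0<\sigma<1$ and $\phi\in C_c^\infty(\mathbb{R}^d)$ let $$(-\Delta)^{\sigma}\phi(x)=\mathrm{p.v.}\;C_{d,\sigma}\int_{\mathbb{R}^d}\frac{\phi(x)-\phi(y)}{|x-y|^{d+2\sigma}}\,dy,\qquad C_{d,\sigma}=\Big(\int_{\mathbb{R}^d}\frac{1-\cos\zeta_1}{|\zeta|^{d+2\sigma}}\,d\zeta\Big)^{-1},$$ and for a function $u\in L^\infty(\mathbb{R}^d)$ let $(-\Delta)^{\sigma}u$ be understood in the sense of distributions, i.e. $(-\Delta)^\sigma u=g\in L^1_{\rm loc}(\mathbb{R}^d)$ means $\int u\,(-\Delta)^\sigma\phi\,dx=\int g\,\phi\,dx$ for all $\phi\in C_c^\infty(\mathbb{R}^d)$. Let $\dot H^s(\mathbb{R}^d)$ be the closure (as a space of functions) of $C_c^\infty(\mathbb{R}^d)$ with respect to the norm $$\|\phi\|_{\dot H^s}^2=\frac{C_{d,s}}{2}\int_{\mathbb{R}^d}\int_{\mathbb{R}^d}\frac{(\phi(x)-\phi(y))^2}{|x-y|^{d+2s}}\,dx\,dy,$$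 i.e. the set of functions $v$ for which there are $\phi_n\in C_c^\infty(\mathbb{R}^d)$ with $\|\phi_n-v\|_{\dot H^s}\to0$ and $\phi_n\to v$ almost everywhere. Then for every nonnegative $v\in L^\infty(\mathbb{R}^d)\cap\dot H^s(\mathbb{R}^d)$ such that $(-\Delta)^s v\in L^1(\mathbb{R}^d)$, and for every $q>1$, the function $v^{q-1}(-\Delta)^s v$ is integrable, $(-\Delta)^{s/2}(v^{q/2})$ belongs to $L^2(\mathbb{R}^d)$, and $$\int_{\mathbb{R}^d} v^{q-1}(x)\,(-\Delta)^s v(x)\,dx\;\ge\;\frac{4(q-1)}{q^2}\int_{\mathbb{R}^d}\big|(-\Delta)^{s/2}\big(v^{q/2}\big)(x)\big|^2\,dx .$$ -/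

import Mathlib

open MeasureTheory Filter Topology
open scoped ENNReal ContDiff

noncomputable section

namespace FracLap

/-- Euclidean space `ℝ^d`. -/
abbrev E (d : ℕ) : Type := EuclideanSpace ℝ (Fin d)

/-- Test functions: real-valued, smooth and compactly supported. -/
def IsTest {d : ℕ} (φ : E d → ℝ) : Prop :=
  ContDiff ℝ ∞ φ ∧ HasCompactSupport φ

/-- The normalising constant `C_{d,s} = (∫ (1 - cos ζ₁) / |ζ|^{d+2s} dζ)⁻¹` for which the
singular integral below has Fourier symbol `|ξ|^{2s}`. -/
def fracConst (d : ℕ) [NeZero d] (s : ℝ) : ℝ :=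
  (∫ ζ : E d, (1 - Real.cos (ζ 0)) / ‖ζ‖ ^ ((d : ℝ) + 2 * s))⁻¹

/-- `(-Δ)^s φ (x) = p.v. C_{d,s} ∫ (φ(x) - φ(y)) / |x-y|^{d+2s} dy`. It is only ever applied to
test functions with `0 < s < 1`, for which the principal value exists at every point. -/
def fracLap {d : ℕ} [NeZero d] (s : ℝ) (φ : E d → ℝ) (x : E d) : ℝ :=
  fracConst d s * limUnder (𝓝[>] (0 : ℝ)) (fun ε : ℝ =>
    ∫ y in {y : E d | ε < ‖x - y‖}, (φ x - φ y) / ‖x - y‖ ^ ((d : ℝ) + 2 * s))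

/-- `(-Δ)^s u = g` in the sense of distributions, where `g` is a locally integrable function:
`∫ u (-Δ)^s φ = ∫ g φ` for every test function `φ`. -/
def HasFracLap {d : ℕ} [NeZero d] (s : ℝ) (u g : E d → ℝ) : Prop :=
  LocallyIntegrable g volume ∧
  ∀ φ : E d → ℝ, IsTest φ →
    Integrable (fun x => u x * fracLap s φ x) volume ∧
    ∫ x, u x * fracLap s φ x = ∫ x, g x * φ x

/-- The squared homogeneous norm
`(C_{d,s} / 2) ∫∫ (u(x) - u(y))² / |x-y|^{d+2s} dx dy`, with values in `[0,∞]`. -/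
def hdotSq {d : ℕ} [NeZero d] (s : ℝ) (u : E d → ℝ) : ℝ≥0∞ :=
  ENNReal.ofReal (fracConst d s / 2) *
    ∫⁻ x : E d, ∫⁻ y : E d, ENNReal.ofReal ((u x - u y) ^ 2 / ‖x - y‖ ^ ((d : ℝ) + 2 * s))

/-- Membership in the homogeneous space `Ḣ^s(ℝ^d)`, the closure of the test functions with
respect to `hdotSq`, realised as a space of functions: `v` is a limit of test functions both in
the homogeneous norm and almost everywhere. (The norm alone does not see additive constants;
the almost everywhere convergence selects the representative in the completion.) -/
def MemHdot {d : ℕ} [NeZero d] (s : ℝ) (v : E d → ℝ) : Prop :=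
  ∃ φ : ℕ → E d → ℝ, (∀ n, IsTest (φ n)) ∧
    Tendsto (fun n => hdotSq s (fun x => φ n x - v x)) atTop (𝓝 0) ∧
    ∀ᵐ x : E d, Tendsto (fun n => φ n x) atTop (𝓝 (v x))

end FracLap

end

/-! Test the equation for `v` with `v ^ (q - 1)`: the left-hand side is the Gagliardo form
`(C/2) ∬ (v x - v y) (v x ^ (q - 1) - v y ^ (q - 1)) / |x - y| ^ (d + 2 s)`, and the pointwise
Stroock–Varopoulos inequality bounds the integrand below by
`4 (q - 1) / q² * (v x ^ (q / 2) - v y ^ (q / 2))²`. Since `t ↦ t ^ (q - 1)` is in general neither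
smooth nor Lipschitz at `0`, the test function is built from a smooth `h` which equals
`(t + δ) ^ (q - 1) - δ ^ (q - 1)` on the range of `v`, and `δ → 0` at the end.

The fractional Laplacian of order `s / 2` of `v ^ (q / 2)` is obtained by duality: for a test
function `u`, Plancherel and Cauchy–Schwarz give `(∫ u (-Δ)^{s/2} φ)² ≤ ℰ(u, u) ‖φ‖²`, this bound
survives limits in the homogeneous norm, and the Riesz representation theorem turns it into a
function in `L²`. -/

noncomputable section

namespace FracLap

section Lp

variable {α : Type*} [MeasurableSpace α] {μ : Measure α}

lemma exists_ae_norm_le_of_memLp_top {β : Type*} [NormedAddCommGroup β] {f : α → β}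
    (hf : MemLp f ⊤ μ) : ∃ M, 0 ≤ M ∧ ∀ᵐ a ∂μ, ‖f a‖ ≤ M := by
  refine ⟨(eLpNorm f ⊤ μ).toReal, ENNReal.toReal_nonneg, ?_⟩
  rw [eLpNorm_exponent_top]
  filter_upwards [ae_le_eLpNormEssSup (f := f) (μ := μ)] with a ha
  simpa using ENNReal.toReal_mono (eLpNorm_exponent_top (f := f) ▸ hf.2.ne) ha

lemma memLp_top_comp_quasiMeasurePreserving {α' β : Type*} [MeasurableSpace α']
    [NormedAddCommGroup β] {ν : Measure α'} {f : α → β} {g : α' → α} (hf : MemLp f ⊤ μ)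
    (hg : Measure.QuasiMeasurePreserving g ν μ) : MemLp (fun a => f (g a)) ⊤ ν := by
  obtain ⟨M, -, hM⟩ := exists_ae_norm_le_of_memLp_top hf
  exact memLp_top_of_bound (hf.1.comp_quasiMeasurePreserving hg) M (hg.ae hM)

lemma integrable_inner_of_memLp_two (𝕜 : Type*) {V : Type*} [RCLike 𝕜] [NormedAddCommGroup V]
    [InnerProductSpace 𝕜 V] {F G : α → V} (hF : MemLp F 2 μ) (hG : MemLp G 2 μ) :
    Integrable (fun a => (inner 𝕜 (F a) (G a) : 𝕜)) μ := by
  refine (L2.integrable_inner (𝕜 := 𝕜) (hF.toLp F) (hG.toLp G)).congr ?_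
  filter_upwards [hF.coeFn_toLp, hG.coeFn_toLp] with a hFa hGa
  rw [hFa, hGa]

section InnerProductSpace

variable {V : Type*} [NormedAddCommGroup V] [InnerProductSpace ℝ V] {F G : α → V}

lemma inner_toLp_toLp (hF : MemLp F 2 μ) (hG : MemLp G 2 μ) :
    inner ℝ (hF.toLp F) (hG.toLp G) = ∫ a, inner ℝ (F a) (G a) ∂μ := by
  rw [L2.inner_def]
  refine integral_congr_ae ?_
  filter_upwards [hF.coeFn_toLp, hG.coeFn_toLp] with a hFa hGa
  rw [hFa, hGa]

lemma sq_integral_inner_le (hF : MemLp F 2 μ) (hG : MemLp G 2 μ) :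
    (∫ a, inner ℝ (F a) (G a) ∂μ) ^ 2 ≤ (∫ a, ‖F a‖ ^ 2 ∂μ) * ∫ a, ‖G a‖ ^ 2 ∂μ := by
  have cauchy_schwarz := real_inner_mul_inner_self_le (hF.toLp F) (hG.toLp G)
  simp only [inner_toLp_toLp] at cauchy_schwarz
  simpa only [real_inner_self_eq_norm_sq, ← sq] using cauchy_schwarz

end InnerProductSpace

lemma tendsto_integral_mul {F G : ℕ → α → ℝ} {F₀ G₀ : α → ℝ}
    (hF : ∀ n, MemLp (F n) 2 μ) (hG : ∀ n, MemLp (G n) 2 μ)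
    (hF₀ : MemLp F₀ 2 μ) (hG₀ : MemLp G₀ 2 μ)
    (hFl : Tendsto (fun n => eLpNorm (F n - F₀) 2 μ) atTop (𝓝 0))
    (hGl : Tendsto (fun n => eLpNorm (G n - G₀) 2 μ) atTop (𝓝 0)) :
    Tendsto (fun n => ∫ a, F n a * G n a ∂μ) atTop (𝓝 (∫ a, F₀ a * G₀ a ∂μ)) := by
  have tendsto_inner := Tendsto.inner (𝕜 := ℝ)
    ((Lp.tendsto_Lp_iff_tendsto_eLpNorm'' F hF F₀ hF₀).2 hFl)
    ((Lp.tendsto_Lp_iff_tendsto_eLpNorm'' G hG G₀ hG₀).2 hGl)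
  simpa only [inner_toLp_toLp, RCLike.inner_apply, conj_trivial, mul_comm] using tendsto_inner

lemma tendsto_eLpNorm_of_norm_le_of_tendsto {β γ : Type*} [NormedAddCommGroup β]
    [NormedAddCommGroup γ] {p : ℝ≥0∞} (hp : 1 ≤ p) (hp' : p ≠ ⊤)
    {F : ℕ → α → β} {F₀ : α → β} {G : ℕ → α → γ} {G₀ : α → γ}
    (hF : ∀ n, AEStronglyMeasurable (F n) μ) (hF₀ : MemLp F₀ p μ)
    (hG : ∀ n, MemLp (G n) p μ) (hG₀ : MemLp G₀ p μ)
    (hle : ∀ n, ∀ᵐ a ∂μ, ‖F n a‖ ≤ ‖G n a‖)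
    (hGl : Tendsto (fun n => eLpNorm (G n - G₀) p μ) atTop (𝓝 0))
    (hFl : ∀ᵐ a ∂μ, Tendsto (fun n => F n a) atTop (𝓝 (F₀ a))) :
    Tendsto (fun n => eLpNorm (F n - F₀) p μ) atTop (𝓝 0) := by
  obtain ⟨-, hui, hut⟩ :=
    (tendstoInMeasure_iff_tendsto_Lp hp hp' hG hG₀).2 hGl
  have indicator_le : ∀ n (S : Set α),
      eLpNorm (S.indicator (F n)) p μ ≤ eLpNorm (S.indicator (G n)) p μ := fun n S =>
    eLpNorm_mono_ae <| (hle n).mono fun a ha => by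
      rw [norm_indicator_eq_indicator_norm, norm_indicator_eq_indicator_norm]
      exact Set.indicator_le_indicator ha
  refine tendsto_Lp_of_tendsto_ae hp hp' hF hF₀ (fun ε hε => ?_) (fun ε hε => ?_) hFl
  · obtain ⟨δ, hδ, h⟩ := hui hε
    exact ⟨δ, hδ, fun n S hS hSδ => (indicator_le n S).trans (h n S hS hSδ)⟩
  · obtain ⟨S, hS, h⟩ := hut hε
    exact ⟨S, hS, fun n => (indicator_le n Sᶜ).trans (h n)⟩

end Lp

lemma integrableOn_Ioi_min_one_sq_mul_rpow {s : ℝ} (hs : s ∈ Set.Ioo 0 1) :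
    IntegrableOn (fun r : ℝ => min 1 (r ^ 2) * r ^ (-1 - 2 * s)) (Set.Ioi 0) := by
  rw [← Set.Ioc_union_Ioi_eq_Ioi zero_le_one, integrableOn_union]
  constructor
  · have integrableOn_rpow : IntegrableOn (fun r : ℝ => r ^ (1 - 2 * s)) (Set.Ioc 0 1) := by
      rw [← intervalIntegrable_iff_integrableOn_Ioc_of_le zero_le_one]
      exact intervalIntegral.intervalIntegrable_rpow' (by linarith [hs.2])
    refine integrableOn_rpow.congr_fun (fun r hr => ?_) measurableSet_Ioc
    simp only
    rw [min_eq_right (pow_le_one₀ hr.1.le hr.2), ← Real.rpow_natCast, ← Real.rpow_add hr.1]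
    congr 1
    push_cast
    ring
  · have integrableOn_rpow : IntegrableOn (fun r : ℝ => r ^ (-1 - 2 * s)) (Set.Ioi 1) :=
      integrableOn_Ioi_rpow_of_lt (by linarith [hs.1]) one_pos
    refine integrableOn_rpow.congr_fun (fun r hr => ?_) measurableSet_Ioi
    simp only
    rw [min_eq_left (one_le_pow₀ (Set.mem_Ioi.1 hr).le), one_mul]

section NormedSpace

variable {V : Type*} [NormedAddCommGroup V] [NormedSpace ℝ V] [FiniteDimensional ℝ V]
  [MeasurableSpace V] [BorelSpace V] (μ : Measure V) [μ.IsAddHaarMeasure]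

lemma integrable_min_one_sq_mul_norm_rpow [Nontrivial V] {s : ℝ} (hs : s ∈ Set.Ioo 0 1) :
    Integrable
      (fun z : V => min 1 (‖z‖ ^ 2) * (‖z‖ ^ ((Module.finrank ℝ V : ℝ) + 2 * s))⁻¹) μ := by
  refine (integrable_fun_norm_addHaar μ
    (f := fun r => min 1 (r ^ 2) * (r ^ ((Module.finrank ℝ V : ℝ) + 2 * s))⁻¹)).2 ?_
  refine (integrableOn_Ioi_min_one_sq_mul_rpow hs).congr_fun (fun r hr => ?_) measurableSet_Ioi
  have hr : 0 < r := hr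
  simp only
  rw [smul_eq_mul, mul_left_comm, ← Real.rpow_natCast r (_ - 1), ← Real.rpow_neg hr.le,
    ← Real.rpow_add hr, Nat.cast_sub Module.finrank_pos]
  congr 2
  push_cast
  ring

lemma integrableOn_norm_rpow_inv {r ε : ℝ} (hr : (Module.finrank ℝ V : ℝ) < r) (hε : 0 < ε) :
    IntegrableOn (fun z : V => (‖z‖ ^ r)⁻¹) {z | ε < ‖z‖} μ := by
  have hr0 : 0 ≤ r := (Nat.cast_nonneg _).trans hr.le
  refine (((integrable_one_add_norm (μ := μ) hr).const_mul
    ((1 + ε⁻¹) ^ r)).integrableOn).mono' (by fun_prop) ?_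
  refine ae_restrict_of_forall_mem (measurableSet_lt measurable_const measurable_norm)
    fun z (hz : ε < ‖z‖) => ?_
  have hz0 : 0 < ‖z‖ := hε.trans hz
  have one_add_norm_le : 1 + ‖z‖ ≤ (1 + ε⁻¹) * ‖z‖ := by
    have : 1 ≤ ε⁻¹ * ‖z‖ := by rw [inv_mul_eq_div, one_le_div hε]; exact hz.le
    linarith
  rw [Real.norm_of_nonneg (by positivity), Real.rpow_neg (by positivity), ← div_eq_mul_inv,
    inv_le_iff_one_le_mul₀ (by positivity), div_mul_eq_mul_div, one_le_div (by positivity),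
    ← Real.mul_rpow (by positivity) (by positivity)]
  exact Real.rpow_le_rpow (by positivity) one_add_norm_le hr0

end NormedSpace

section Kernel

variable {d : ℕ} {s : ℝ}

/-- The kernel `|z|^{-(d+2s)}` of the fractional Laplacian, with junk value `0` at `z = 0`. -/
def fracKernel (s : ℝ) (z : E d) : ℝ := (‖z‖ ^ ((d : ℝ) + 2 * s))⁻¹

lemma fracKernel_nonneg (s : ℝ) (z : E d) : 0 ≤ fracKernel s z := by
  unfold fracKernel
  positivity

lemma fracKernel_pos (s : ℝ) {z : E d} (hz : z ≠ 0) : 0 < fracKernel s z := by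
  have := norm_pos_iff.2 hz
  unfold fracKernel
  positivity

@[fun_prop]
lemma measurable_fracKernel (s : ℝ) : Measurable (fracKernel s : E d → ℝ) := by
  unfold fracKernel
  fun_prop

lemma fracKernel_map (s : ℝ) (R : E d ≃ₗᵢ[ℝ] E d) (z : E d) :
    fracKernel s (R z) = fracKernel s z := by
  rw [fracKernel, R.norm_map, fracKernel]

lemma fracKernel_smul (s : ℝ) {a : ℝ} (ha : 0 ≤ a) (z : E d) :
    fracKernel s (a • z) = (a ^ ((d : ℝ) + 2 * s))⁻¹ * fracKernel s z := by
  rw [fracKernel, norm_smul, Real.norm_of_nonneg ha, Real.mul_rpow ha (norm_nonneg _), mul_inv,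
    fracKernel]

lemma integrableOn_fracKernel (hs : 0 < s) {ε : ℝ} (hε : 0 < ε) :
    IntegrableOn (fracKernel s) {z : E d | ε < ‖z‖} :=
  integrableOn_norm_rpow_inv volume (by rw [finrank_euclideanSpace_fin]; linarith) hε

lemma one_sub_cos_le (t : ℝ) : 1 - Real.cos t ≤ 2 * min 1 (t ^ 2) := by
  rcases le_total 1 (t ^ 2) with h | h
  · rw [min_eq_left h]; linarith [Real.neg_one_le_cos t]
  · rw [min_eq_right h]; nlinarith [Real.one_sub_sq_div_two_le_cos (x := t), sq_nonneg t]

lemma min_one_mul_le {a r : ℝ} (ha : 0 ≤ a) (hr : 0 ≤ r) :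
    min 1 (a * r) ≤ (1 + a) * min 1 r := by
  rcases le_total 1 r with h | h
  · rw [min_eq_left h]
    exact (min_le_left _ _).trans (by linarith)
  · rw [min_eq_right h]
    exact (min_le_right _ _).trans (by linarith)

lemma one_sub_cos_inner_le (ξ z : E d) :
    1 - Real.cos (inner ℝ ξ z) ≤ 2 * (1 + ‖ξ‖ ^ 2) * min 1 (‖z‖ ^ 2) := by
  have inner_sq_le : (inner ℝ ξ z) ^ 2 ≤ ‖ξ‖ ^ 2 * ‖z‖ ^ 2 := by
    rw [← mul_pow]
    exact sq_le_sq' (neg_le_of_abs_le (abs_real_inner_le_norm ξ z)) (real_inner_le_norm ξ z)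
  calc 1 - Real.cos (inner ℝ ξ z) ≤ 2 * min 1 ((inner ℝ ξ z) ^ 2) := one_sub_cos_le _
    _ ≤ 2 * min 1 (‖ξ‖ ^ 2 * ‖z‖ ^ 2) := by gcongr
    _ ≤ 2 * ((1 + ‖ξ‖ ^ 2) * min 1 (‖z‖ ^ 2)) := by
      gcongr
      exact min_one_mul_le (by positivity) (by positivity)
    _ = _ := by ring

lemma integral_one_sub_cos_inner_mul_fracKernel_eq_of_norm_eq {ξ η : E d} (h : ‖ξ‖ = ‖η‖) :
    ∫ z : E d, (1 - Real.cos (inner ℝ ξ z)) * fracKernel s z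
      = ∫ z : E d, (1 - Real.cos (inner ℝ η z)) * fracKernel s z := by
  let R : E d ≃ₗᵢ[ℝ] E d := (ℝ ∙ (ξ - η))ᗮ.reflection
  have hR : R ξ = η := Submodule.reflection_sub h
  rw [← R.measurePreserving.integral_comp R.toHomeomorph.measurableEmbedding
    (fun z => (1 - Real.cos (inner ℝ η z)) * fracKernel s z)]
  refine integral_congr_ae (Eventually.of_forall fun z => ?_)
  simp only [fracKernel_map]
  rw [← hR, R.inner_map_map]

lemma integral_one_sub_cos_inner_smul_mul_fracKernel {r : ℝ} (hr : 0 < r) (ξ : E d) :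
    ∫ z : E d, (1 - Real.cos (inner ℝ (r • ξ) z)) * fracKernel s z
      = r ^ (2 * s) * ∫ z : E d, (1 - Real.cos (inner ℝ ξ z)) * fracKernel s z := by
  have rescale : ∀ z : E d, (1 - Real.cos (inner ℝ (r • ξ) z)) * fracKernel s z
      = r ^ ((d : ℝ) + 2 * s) * ((1 - Real.cos (inner ℝ ξ (r • z))) * fracKernel s (r • z)) := by
    intro z
    rw [fracKernel_smul s hr.le, real_inner_smul_left, real_inner_smul_right]
    field_simp
  simp only [rescale]
  rw [integral_const_mul, Measure.integral_comp_smul volume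
      (fun z : E d => (1 - Real.cos (inner ℝ ξ z)) * fracKernel s z),
    finrank_euclideanSpace_fin, abs_of_nonneg (by positivity), smul_eq_mul, Real.rpow_add hr,
    Real.rpow_natCast]
  field_simp

variable [NeZero d]

lemma integrable_min_one_sq_mul_fracKernel (hs : s ∈ Set.Ioo 0 1) :
    Integrable fun z : E d => min 1 (‖z‖ ^ 2) * fracKernel s z := by
  simpa only [finrank_euclideanSpace_fin, fracKernel] using
    integrable_min_one_sq_mul_norm_rpow (volume : Measure (E d)) hs

lemma integrable_one_sub_cos_mul_fracKernel (hs : s ∈ Set.Ioo 0 1) (ξ : E d) :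
    Integrable fun z : E d => (1 - Real.cos (inner ℝ ξ z)) * fracKernel s z := by
  refine ((integrable_min_one_sq_mul_fracKernel hs).const_mul (2 * (1 + ‖ξ‖ ^ 2))).mono'
    (by fun_prop) (Eventually.of_forall fun z => ?_)
  have one_sub_cos_nonneg : 0 ≤ 1 - Real.cos (inner ℝ ξ z) := sub_nonneg.2 (Real.cos_le_one _)
  rw [Real.norm_of_nonneg (mul_nonneg one_sub_cos_nonneg (fracKernel_nonneg s z)), ← mul_assoc]
  exact mul_le_mul_of_nonneg_right (one_sub_cos_inner_le ξ z) (fracKernel_nonneg s z)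

lemma fracConst_eq (s : ℝ) :
    fracConst d s = (∫ z : E d, (1 - Real.cos (z 0)) * fracKernel s z)⁻¹ := by
  simp only [fracConst, fracKernel, div_eq_mul_inv]

lemma inner_single_zero (z : E d) :
    inner ℝ (EuclideanSpace.single 0 1 : E d) z = z 0 := by
  simp [EuclideanSpace.inner_single_left]

lemma fracConst_pos (hs : s ∈ Set.Ioo 0 1) : 0 < fracConst d s := by
  have integrable := integrable_one_sub_cos_mul_fracKernel hs (EuclideanSpace.single 0 1 : E d)
  simp only [inner_single_zero] at integrable
  have nonneg : ∀ z : E d, 0 ≤ (1 - Real.cos (z 0)) * fracKernel s z := fun z =>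
    mul_nonneg (sub_nonneg.2 (Real.cos_le_one _)) (fracKernel_nonneg s z)
  rw [fracConst_eq, inv_pos, integral_pos_iff_support_of_nonneg nonneg integrable]
  have isOpen : IsOpen {z : E d | 0 < z 0 ∧ z 0 < 1} :=
    IsOpen.and (isOpen_lt continuous_const (by fun_prop)) (isOpen_lt (by fun_prop) continuous_const)
  have nonempty : {z : E d | 0 < z 0 ∧ z 0 < 1}.Nonempty :=
    ⟨EuclideanSpace.single 0 (1 / 2), by simp; norm_num⟩
  refine (isOpen.measure_pos volume nonempty).trans_le (measure_mono fun z hz => ?_)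
  have hz0 : z ≠ 0 := by rintro rfl; simpa using hz.1
  have cos_lt_one : Real.cos (z 0) < 1 := by
    rw [← Real.cos_zero]
    exact Real.cos_lt_cos_of_nonneg_of_le_pi le_rfl (by linarith [hz.2, Real.pi_gt_three]) hz.1
  exact (mul_pos (sub_pos.2 cos_lt_one) (fracKernel_pos s hz0)).ne'

lemma fracConst_mul_integral_one_sub_cos (hs : s ∈ Set.Ioo 0 1) (ξ : E d) :
    fracConst d s * ∫ z : E d, (1 - Real.cos (inner ℝ ξ z)) * fracKernel s z
      = ‖ξ‖ ^ (2 * s) := by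
  rcases eq_or_ne ξ 0 with rfl | hξ
  · simp [Real.zero_rpow (by linarith [hs.1] : (2 * s) ≠ 0)]
  have norm_eq : ‖ξ‖ = ‖‖ξ‖ • (EuclideanSpace.single 0 1 : E d)‖ := by simp [norm_smul]
  rw [integral_one_sub_cos_inner_mul_fracKernel_eq_of_norm_eq norm_eq,
    integral_one_sub_cos_inner_smul_mul_fracKernel (norm_pos_iff.2 hξ), mul_left_comm]
  simp only [inner_single_zero]
  rw [← inv_inv (∫ z : E d, (1 - Real.cos (z 0)) * fracKernel s z), ← fracConst_eq,
    mul_inv_cancel₀ (fracConst_pos hs).ne', mul_one]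

end Kernel

/-- The symmetric second difference of `φ` at `x` with step `z`, halved and with the sign of the
fractional Laplacian. -/
def secondDiff {G : Type*} [AddGroup G] (φ : G → ℝ) (z x : G) : ℝ :=
  φ x - (φ (x + z) + φ (x - z)) / 2

section Invariant

variable {G : Type*} [AddGroup G] [MeasurableSpace G] [MeasurableAdd G] {μ : Measure G}
  [μ.IsAddRightInvariant] {φ : G → ℝ}

lemma integrable_secondDiff (hφ : Integrable φ μ) (z : G) : Integrable (secondDiff φ z) μ :=
  hφ.sub (((hφ.comp_add_right z).add (hφ.comp_sub_right z)).div_const 2)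

lemma integral_abs_secondDiff_le (hφ : Integrable φ μ) (z : G) :
    ∫ x, |secondDiff φ z x| ∂μ ≤ 2 * ∫ x, |φ x| ∂μ := by
  have hadd := hφ.abs.comp_add_right z
  have hsub := hφ.abs.comp_sub_right z
  have hmean : Integrable (fun x => (|φ (x + z)| + |φ (x - z)|) / 2) μ :=
    (hadd.add hsub).div_const 2
  calc ∫ x, |secondDiff φ z x| ∂μ
      ≤ ∫ x, (|φ x| + (|φ (x + z)| + |φ (x - z)|) / 2) ∂μ := by
        refine integral_mono (integrable_secondDiff hφ z).abs (hφ.abs.add hmean) fun x => ?_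
        refine (abs_sub _ _).trans ?_
        rw [abs_div, abs_two]
        gcongr
        exact abs_add_le _ _
    _ = 2 * ∫ x, |φ x| ∂μ := by
        rw [integral_add hφ.abs hmean, integral_div, integral_add hadd hsub,
          integral_add_right_eq_self (fun x => |φ x|), integral_sub_right_eq_self (fun x => |φ x|)]
        ring

lemma integral_mul_secondDiff {u : G → ℝ} (hu : MemLp u ⊤ μ) (hφ : Integrable φ μ) (z : G) :
    ∫ x, u x * secondDiff φ z x ∂μ
      = (∫ x, (u (x + z) - u x) * (φ (x + z) - φ x) ∂μ) / 2 := by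
  have hforward : Integrable (fun x => u x * (φ x - φ (x + z))) μ :=
    (hφ.sub (hφ.comp_add_right z)).mul_of_top_right hu
  have hbackward : Integrable (fun x => u x * (φ x - φ (x - z))) μ :=
    (hφ.sub (hφ.comp_sub_right z)).mul_of_top_right hu
  have htranslated : Integrable (fun x => u (x + z) * (φ (x + z) - φ x)) μ :=
    ((hφ.comp_add_right z).sub hφ).mul_of_top_right
      (hu.comp_measurePreserving (measurePreserving_add_right μ z))
  have translate : ∫ x, u x * (φ x - φ (x - z)) ∂μ = ∫ x, u (x + z) * (φ (x + z) - φ x) ∂μ := by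
    rw [← integral_add_right_eq_self _ z]
    simp only [add_sub_cancel_right]
  calc ∫ x, u x * secondDiff φ z x ∂μ
      = ((∫ x, u x * (φ x - φ (x + z)) ∂μ) + ∫ x, u x * (φ x - φ (x - z)) ∂μ) / 2 := by
        rw [← integral_add hforward hbackward, ← integral_div]
        congr! 2
        rw [secondDiff]
        ring
    _ = _ := by
        rw [translate, ← integral_add hforward htranslated]
        congr! 3 with x
        ring

end Invariant

lemma abs_secondDiff_le_of_lipschitzWith_fderiv {V : Type*} [NormedAddCommGroup V]
    [NormedSpace ℝ V] {φ : V → ℝ} (hφ : Differentiable ℝ φ) {C : NNReal}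
    (hC : LipschitzWith C (fderiv ℝ φ)) (z x : V) :
    |secondDiff φ z x| ≤ C / 2 * ‖z‖ ^ 2 := by
  let F : V → ℝ := fun y => φ (y + z) - φ y
  have hasFDerivAt : ∀ y, HasFDerivAt F (fderiv ℝ φ (y + z) - fderiv ℝ φ y) y := fun y =>
    ((hasFDerivAt_comp_add_right z).2 (hφ (y + z)).hasFDerivAt).sub (hφ y).hasFDerivAt
  have increment_le : ‖F x - F (x - z)‖ ≤ C * ‖z‖ * ‖x - (x - z)‖ := by
    refine convex_univ.norm_image_sub_le_of_norm_hasFDerivWithin_le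
      (fun y _ => (hasFDerivAt y).hasFDerivWithinAt) (fun y _ => ?_) trivial trivial
    simpa only [dist_eq_norm, add_sub_cancel_left] using hC.dist_le_mul (y + z) y
  have secondDiff_eq : secondDiff φ z x = -(F x - F (x - z)) / 2 := by
    simp only [F, secondDiff, sub_add_cancel]
    ring
  rw [sub_sub_cancel, Real.norm_eq_abs] at increment_le
  rw [secondDiff_eq, abs_div, abs_neg, abs_two]
  linarith

section IsTest

variable {d : ℕ} {φ ψ : E d → ℝ}

lemma IsTest.continuous (hφ : IsTest φ) : Continuous φ := hφ.1.continuous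

lemma IsTest.memLp (hφ : IsTest φ) (p : ℝ≥0∞) : MemLp φ p :=
  hφ.continuous.memLp_of_hasCompactSupport hφ.2

lemma IsTest.integrable (hφ : IsTest φ) : Integrable φ :=
  hφ.continuous.integrable_of_hasCompactSupport hφ.2

lemma IsTest.comp_add_right (hφ : IsTest φ) (z : E d) : IsTest fun x => φ (x + z) :=
  ⟨hφ.1.comp (contDiff_id.add contDiff_const), hφ.2.comp_homeomorph (Homeomorph.addRight z)⟩

lemma IsTest.sub (hφ : IsTest φ) (hψ : IsTest ψ) : IsTest fun x => φ x - ψ x :=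
  ⟨hφ.1.sub hψ.1, hφ.2.sub hψ.2⟩

lemma IsTest.exists_abs_secondDiff_le (hφ : IsTest φ) :
    ∃ C, 0 ≤ C ∧ ∀ z x, |secondDiff φ z x| ≤ C * ‖z‖ ^ 2 := by
  have contDiff_fderiv : ContDiff ℝ 1 (fderiv ℝ φ) := hφ.1.fderiv_right (by norm_cast)
  obtain ⟨C, hC⟩ :=
    contDiff_fderiv.lipschitzWith_of_hasCompactSupport (hφ.2.fderiv (𝕜 := ℝ)) one_ne_zero
  exact ⟨C / 2, by positivity, abs_secondDiff_le_of_lipschitzWith_fderiv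
    (hφ.1.differentiable (by simp)) hC⟩

lemma IsTest.exists_integral_abs_secondDiff_le_sq (hφ : IsTest φ) :
    ∃ C, 0 ≤ C ∧ ∀ z, ‖z‖ ≤ 1 → ∫ x, |secondDiff φ z x| ≤ C * ‖z‖ ^ 2 := by
  obtain ⟨C, hC0, hC⟩ := hφ.exists_abs_secondDiff_le
  obtain ⟨R, hR⟩ := hφ.2.isCompact.isBounded.subset_closedBall (0 : E d)
  have eq_zero : ∀ y : E d, R < ‖y‖ → φ y = 0 := fun y hy =>
    image_eq_zero_of_notMem_tsupport fun hmem => hy.not_ge (mem_closedBall_zero_iff.1 (hR hmem))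
  let B : Set (E d) := Metric.closedBall 0 (R + 1)
  refine ⟨C * volume.real B, by positivity, fun z hz => ?_⟩
  have support_subset : ∀ x ∉ B, |secondDiff φ z x| = 0 := fun x hx => by
    rw [mem_closedBall_zero_iff, not_le] at hx
    have hadd := norm_sub_le (x + z) z
    have hsub := norm_add_le (x - z) z
    rw [add_sub_cancel_right] at hadd
    rw [sub_add_cancel] at hsub
    simp [secondDiff, eq_zero x (by linarith), eq_zero (x + z) (by linarith),
      eq_zero (x - z) (by linarith)]
  rw [← setIntegral_eq_integral_of_forall_compl_eq_zero support_subset, mul_right_comm]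
  refine (Real.le_norm_self _).trans (norm_setIntegral_le_of_norm_le_const
    (isCompact_closedBall (0 : E d) (R + 1)).measure_lt_top fun x _ => ?_)
  rw [Real.norm_eq_abs, abs_abs]
  exact hC z x

lemma IsTest.exists_integral_abs_secondDiff_le (hφ : IsTest φ) :
    ∃ C, ∀ z, ∫ x, |secondDiff φ z x| ≤ C * min 1 (‖z‖ ^ 2) := by
  obtain ⟨C, hC0, hC⟩ := hφ.exists_integral_abs_secondDiff_le_sq
  have integral_abs_nonneg : 0 ≤ ∫ x, |φ x| := integral_nonneg fun _ => abs_nonneg _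
  refine ⟨2 * (∫ x, |φ x|) + C, fun z => ?_⟩
  rcases le_total 1 ‖z‖ with hz | hz
  · rw [min_eq_left (one_le_pow₀ hz), mul_one]
    linarith [integral_abs_secondDiff_le hφ.integrable z]
  · rw [min_eq_right (pow_le_one₀ (norm_nonneg z) hz)]
    refine (hC z hz).trans ?_
    gcongr
    linarith

end IsTest

section Form

variable {d : ℕ} {s : ℝ} {u w φ : E d → ℝ}

/-- The second difference weighted by the kernel, as a function of (point, step): its integral
over the step is the singular integral defining `(-Δ)^s φ`, up to `fracConst`. -/
def fracSecondDiff (s : ℝ) (φ : E d → ℝ) (p : E d × E d) : ℝ :=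
  secondDiff φ p.2 p.1 * fracKernel s p.2

/-- The first difference weighted by the square root of the kernel, as a function of
(point, step): its `L²` norm is the homogeneous Sobolev norm, up to `fracConst`. -/
def fracIncr (s : ℝ) (u : E d → ℝ) (p : E d × E d) : ℝ :=
  (u (p.1 + p.2) - u p.1) * √(fracKernel s p.2)

lemma fracIncr_sub (s : ℝ) (u w : E d → ℝ) :
    fracIncr s (fun x => u x - w x) = fracIncr s u - fracIncr s w := by
  funext p
  simp only [fracIncr, Pi.sub_apply]
  ring

lemma fracIncr_mul_fracIncr (s : ℝ) (u w : E d → ℝ) (p : E d × E d) :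
    fracIncr s u p * fracIncr s w p
      = (u (p.1 + p.2) - u p.1) * (w (p.1 + p.2) - w p.1) * fracKernel s p.2 := by
  rw [fracIncr, fracIncr, mul_mul_mul_comm, Real.mul_self_sqrt (fracKernel_nonneg s p.2)]

lemma fracIncr_sq (s : ℝ) (u : E d → ℝ) (p : E d × E d) :
    fracIncr s u p ^ 2 = (u (p.1 + p.2) - u p.1) ^ 2 * fracKernel s p.2 := by
  rw [sq, fracIncr_mul_fracIncr, ← sq]

lemma aestronglyMeasurable_fracIncr (s : ℝ) (hu : AEStronglyMeasurable u volume) :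
    AEStronglyMeasurable (fracIncr s u) volume :=
  ((hu.comp_quasiMeasurePreserving (quasiMeasurePreserving_add volume volume)).sub
    hu.comp_fst).mul
    ((measurable_fracKernel s).comp measurable_snd).sqrt.aestronglyMeasurable

/-- The bilinear form of the fractional Laplacian, `⟨(-Δ)^{s/2} u, (-Δ)^{s/2} w⟩` for nice `u`
and `w`. -/
def fracForm [NeZero d] (s : ℝ) (u w : E d → ℝ) : ℝ :=
  fracConst d s / 2 * ∫ p, fracIncr s u p * fracIncr s w p

lemma integral_mul_fracSecondDiff (hu : MemLp u ⊤) (hφ : Integrable φ) (z : E d) :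
    ∫ x, u x * fracSecondDiff s φ (x, z)
      = (∫ x, fracIncr s u (x, z) * fracIncr s φ (x, z)) / 2 := by
  simp only [fracIncr_mul_fracIncr, fracSecondDiff, ← mul_assoc]
  rw [integral_mul_const, integral_mul_const, integral_mul_secondDiff hu hφ z]
  ring

lemma IsTest.setIntegral_eq_setIntegral_fracSecondDiff (hs : 0 < s) (hφ : IsTest φ) (x : E d)
    {ε : ℝ} (hε : 0 < ε) :
    ∫ y in {y : E d | ε < ‖x - y‖}, (φ x - φ y) / ‖x - y‖ ^ ((d : ℝ) + 2 * s)
      = ∫ z in {z | ε < ‖z‖}, fracSecondDiff s φ (x, z) := by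
  have integrableOn_diff : ∀ g : E d → E d, Continuous g →
      IntegrableOn (fun z => (φ x - φ (g z)) * fracKernel s z) {z : E d | ε < ‖z‖} := by
    intro g hg
    obtain ⟨M, hM⟩ := hφ.2.exists_bound_of_continuous hφ.continuous
    exact (integrableOn_fracKernel hs hε).bdd_mul (c := M + M)
      (continuous_const.sub (hφ.continuous.comp hg)).aestronglyMeasurable
      (Eventually.of_forall fun z => norm_sub_le_of_le (hM x) (hM (g z)))
  have measurableSet_shell : MeasurableSet {z : E d | ε < ‖z‖} :=
    measurableSet_lt measurable_const measurable_norm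
  rw [← integral_indicator (measurableSet_lt measurable_const (by fun_prop))]
  set A := ∫ y, {y : E d | ε < ‖x - y‖}.indicator
    (fun y => (φ x - φ y) / ‖x - y‖ ^ ((d : ℝ) + 2 * s)) y with hA
  have forward : A = ∫ z in {z | ε < ‖z‖}, (φ x - φ (x + z)) * fracKernel s z := by
    rw [hA, ← integral_add_left_eq_self _ x, ← integral_indicator measurableSet_shell]
    simp [Set.indicator, fracKernel, div_eq_mul_inv]
  have backward : A = ∫ z in {z | ε < ‖z‖}, (φ x - φ (x - z)) * fracKernel s z := by
    rw [hA, ← integral_sub_left_eq_self _ volume x, ← integral_indicator measurableSet_shell]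
    simp [Set.indicator, fracKernel, div_eq_mul_inv]
  calc A = (A + A) / 2 := by ring
    _ = _ := by
      nth_rewrite 1 [forward]
      rw [backward, ← integral_add (integrableOn_diff _ (by fun_prop))
        (integrableOn_diff _ (by fun_prop)), ← integral_div]
      congr! 2
      simp only [fracSecondDiff, secondDiff]
      ring

lemma aecover_lt_norm [NeZero d] :
    AECover (volume : Measure (E d)) (𝓝[>] (0 : ℝ)) fun ε => {z | ε < ‖z‖} where
  ae_eventually_mem := by
    filter_upwards [Measure.ae_ne volume (0 : E d)] with z hz
    exact nhdsWithin_le_nhds (gt_mem_nhds (norm_pos_iff.2 hz))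
  measurableSet _ := measurableSet_lt measurable_const measurable_norm

variable [NeZero d]

lemma IsTest.integrable_fracSecondDiff (hs : s ∈ Set.Ioo 0 1) (hφ : IsTest φ) :
    Integrable (fracSecondDiff s φ) := by
  obtain ⟨C, hC⟩ := hφ.exists_integral_abs_secondDiff_le
  have aestronglyMeasurable : AEStronglyMeasurable (fracSecondDiff s φ) volume := by
    have := hφ.continuous.measurable
    unfold fracSecondDiff secondDiff
    fun_prop
  refine (integrable_prod_iff' aestronglyMeasurable).2 ⟨Eventually.of_forall fun z =>
    (integrable_secondDiff hφ.integrable z).mul_const (fracKernel s z), ?_⟩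
  refine ((integrable_min_one_sq_mul_fracKernel hs).const_mul C).mono'
    aestronglyMeasurable.norm.prod_swap.integral_prod_right' (Eventually.of_forall fun z => ?_)
  simp only [fracSecondDiff, norm_mul, Real.norm_of_nonneg (fracKernel_nonneg s z)]
  rw [integral_mul_const, norm_mul, Real.norm_of_nonneg (fracKernel_nonneg s z), ← mul_assoc,
    Real.norm_of_nonneg (integral_nonneg fun _ => norm_nonneg _)]
  exact mul_le_mul_of_nonneg_right (hC z) (fracKernel_nonneg s z)

lemma IsTest.fracLap_ae_eq (hs : s ∈ Set.Ioo 0 1) (hφ : IsTest φ) :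
    ∀ᵐ x, fracLap s φ x = fracConst d s * ∫ z, fracSecondDiff s φ (x, z) := by
  filter_upwards [(hφ.integrable_fracSecondDiff hs).prod_right_ae] with x hx
  rw [fracLap]
  congr 1
  refine Tendsto.limUnder_eq
    ((aecover_lt_norm.integral_tendsto_of_countably_generated hx).congr' ?_)
  filter_upwards [self_mem_nhdsWithin] with ε hε
  exact (hφ.setIntegral_eq_setIntegral_fracSecondDiff hs.1 x hε).symm

lemma IsTest.integrable_fracLap (hs : s ∈ Set.Ioo 0 1) (hφ : IsTest φ) :
    Integrable (fracLap s φ) :=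
  ((hφ.integrable_fracSecondDiff hs).integral_prod_left.const_mul (fracConst d s)).congr
    ((hφ.fracLap_ae_eq hs).mono fun _ h => h.symm)

lemma IsTest.integrable_mul_fracLap (hs : s ∈ Set.Ioo 0 1) (hφ : IsTest φ) (hu : MemLp u ⊤) :
    Integrable fun x => u x * fracLap s φ x :=
  (hφ.integrable_fracLap hs).mul_of_top_right hu

lemma IsTest.integrable_mul_fracSecondDiff (hs : s ∈ Set.Ioo 0 1) (hφ : IsTest φ)
    (hu : MemLp u ⊤) : Integrable fun p : E d × E d => u p.1 * fracSecondDiff s φ p :=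
  (hφ.integrable_fracSecondDiff hs).mul_of_top_right
    (memLp_top_comp_quasiMeasurePreserving hu Measure.quasiMeasurePreserving_fst)

lemma IsTest.integral_mul_fracLap_eq (hs : s ∈ Set.Ioo 0 1) (hφ : IsTest φ) (hu : MemLp u ⊤) :
    ∫ x, u x * fracLap s φ x
      = fracConst d s * ∫ p : E d × E d, u p.1 * fracSecondDiff s φ p := by
  rw [Measure.volume_eq_prod, integral_prod _ (hφ.integrable_mul_fracSecondDiff hs hu),
    ← integral_const_mul]
  refine integral_congr_ae ((hφ.fracLap_ae_eq hs).mono fun x hx => ?_)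
  simp only [hx, integral_const_mul]
  ring

lemma IsTest.memLp_fracIncr (hs : s ∈ Set.Ioo 0 1) (hφ : IsTest φ) : MemLp (fracIncr s φ) 2 := by
  have aestronglyMeasurable := aestronglyMeasurable_fracIncr s hφ.continuous.aestronglyMeasurable
  refine (memLp_two_iff_integrable_sq aestronglyMeasurable).2 ?_
  refine (integrable_prod_iff' (aestronglyMeasurable.pow 2)).2
    ⟨Eventually.of_forall fun z => ?_, ?_⟩
  · have hdiff : IsTest fun x => φ (x + z) - φ x := (hφ.comp_add_right z).sub hφ
    refine ((hdiff.memLp 2).integrable_sq.mul_const (fracKernel s z)).congr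
      (Eventually.of_forall fun x => ?_)
    simp only [Pi.pow_apply, fracIncr_sq]
  · refine ((hφ.integrable_mul_fracSecondDiff hs (hφ.memLp ⊤)).integral_prod_right.const_mul
      2).congr (Eventually.of_forall fun z => ?_)
    simp only [integral_mul_fracSecondDiff (hφ.memLp ⊤) hφ.integrable z, Pi.pow_apply,
      Real.norm_eq_abs, abs_sq, ← sq]
    ring

lemma IsTest.integral_mul_fracLap (hs : s ∈ Set.Ioo 0 1) (hφ : IsTest φ) (hu : MemLp u ⊤)
    (hu2 : MemLp (fracIncr s u) 2) : ∫ x, u x * fracLap s φ x = fracForm s u φ := by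
  have integrable : Integrable fun p => fracIncr s u p * fracIncr s φ p :=
    hu2.integrable_mul (hφ.memLp_fracIncr hs)
  rw [hφ.integral_mul_fracLap_eq hs hu, fracForm, Measure.volume_eq_prod,
    integral_prod_symm _ (hφ.integrable_mul_fracSecondDiff hs hu),
    integral_prod_symm _ integrable]
  simp only [integral_mul_fracSecondDiff hu hφ.integrable]
  rw [integral_div]
  ring

end Form

section HdotLimit

variable {d : ℕ} {s : ℝ}

lemma norm_fracIncr_comp_le (s : ℝ) {h : ℝ → ℝ} {K : NNReal} (hK : LipschitzWith K h)
    (u : E d → ℝ) (p : E d × E d) :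
    ‖fracIncr s (fun x => h (u x)) p‖ ≤ ‖((K : ℝ) • fracIncr s u) p‖ := by
  rw [Pi.smul_apply, smul_eq_mul, norm_mul, NNReal.norm_eq, fracIncr, fracIncr, norm_mul,
    norm_mul, ← mul_assoc]
  exact mul_le_mul_of_nonneg_right (hK.norm_sub_le _ _) (norm_nonneg _)

lemma memLp_fracIncr_comp {v : E d → ℝ} (hv : AEStronglyMeasurable v)
    (hv2 : MemLp (fracIncr s v) 2) {h : ℝ → ℝ} {K : NNReal} (hK : LipschitzWith K h) :
    MemLp (fracIncr s fun x => h (v x)) 2 :=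
  (hv2.const_smul (K : ℝ)).mono
    (aestronglyMeasurable_fracIncr s (hK.continuous.comp_aestronglyMeasurable hv))
    (Eventually.of_forall (norm_fracIncr_comp_le s hK v))

lemma IsTest.comp_left {h : ℝ → ℝ} (hh : ContDiff ℝ ∞ h) (h0 : h 0 = 0) {φ : E d → ℝ}
    (hφ : IsTest φ) : IsTest fun x => h (φ x) :=
  ⟨hh.comp hφ.1, hφ.2.comp_left h0⟩

/-- `φ` is a sequence of test functions that converges to `v` almost everywhere and in the
homogeneous Sobolev norm; the latter is encoded as `L²` convergence of the increments. -/
structure HdotApprox (s : ℝ) (φ : ℕ → E d → ℝ) (v : E d → ℝ) : Prop where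
  isTest : ∀ n, IsTest (φ n)
  tendsto : Tendsto (fun n => eLpNorm (fracIncr s (φ n) - fracIncr s v) 2) atTop (𝓝 0)
  ae_tendsto : ∀ᵐ x, Tendsto (fun n => φ n x) atTop (𝓝 (v x))

variable {φ : ℕ → E d → ℝ} {v : E d → ℝ}

lemma HdotApprox.aestronglyMeasurable (H : HdotApprox s φ v) : AEStronglyMeasurable v :=
  aestronglyMeasurable_of_tendsto_ae atTop
    (fun n => (H.isTest n).continuous.aestronglyMeasurable) H.ae_tendsto

lemma ae_tendsto_fracIncr (s : ℝ) (hφ : ∀ᵐ x, Tendsto (fun n => φ n x) atTop (𝓝 (v x))) :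
    ∀ᵐ p : E d × E d, Tendsto (fun n => fracIncr s (φ n) p) atTop (𝓝 (fracIncr s v p)) := by
  filter_upwards [Measure.quasiMeasurePreserving_fst.ae hφ,
    (quasiMeasurePreserving_add volume volume).ae hφ] with p hfst hadd
  exact (hadd.sub hfst).mul_const _

variable [NeZero d]

lemma hdotSq_eq {u : E d → ℝ} (hu : AEStronglyMeasurable u) :
    hdotSq s u = ENNReal.ofReal (fracConst d s / 2) * eLpNorm (fracIncr s u) 2 ^ 2 := by
  have sq_eLpNorm : eLpNorm (fracIncr s u) 2 ^ 2 = ∫⁻ p, ENNReal.ofReal (fracIncr s u p ^ 2) := by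
    have := eLpNorm_nnreal_pow_eq_lintegral (μ := volume) (f := fracIncr s u) (p := 2) two_ne_zero
    simpa [← ofReal_norm, ← ENNReal.ofReal_pow] using this
  have aemeasurable : AEMeasurable (fun p => ENNReal.ofReal (fracIncr s u p ^ 2)) :=
    ((aestronglyMeasurable_fracIncr s hu).aemeasurable.pow_const 2).ennreal_ofReal
  rw [sq_eLpNorm, hdotSq, Measure.volume_eq_prod, lintegral_prod _ aemeasurable]
  congr 1
  refine lintegral_congr fun x => ?_
  rw [← lintegral_add_left_eq_self _ x]
  refine lintegral_congr fun z => ?_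
  rw [fracIncr_sq, fracKernel, sub_add_cancel_left, norm_neg, div_eq_mul_inv, ← neg_sq, neg_sub]

lemma MemHdot.exists_hdotApprox (hs : s ∈ Set.Ioo 0 1) (hv : MemHdot s v) :
    ∃ φ, HdotApprox s φ v := by
  obtain ⟨φ, hφ, hnorm, hae⟩ := hv
  have hvm : AEStronglyMeasurable v := aestronglyMeasurable_of_tendsto_ae atTop
    (fun n => (hφ n).continuous.aestronglyMeasurable) hae
  have hC : ENNReal.ofReal (fracConst d s / 2) ≠ 0 := by
    rw [ne_eq, ENNReal.ofReal_eq_zero, not_le]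
    exact half_pos (fracConst_pos hs)
  have tendsto_sq : Tendsto (fun n => eLpNorm (fracIncr s (φ n) - fracIncr s v) 2 ^ 2) atTop
      (𝓝 0) := by
    have := ENNReal.Tendsto.const_mul hnorm (Or.inr (ENNReal.inv_ne_top.2 hC))
    rw [mul_zero] at this
    refine this.congr fun n => ?_
    rw [hdotSq_eq (u := fun x => φ n x - v x)
      ((hφ n).continuous.aestronglyMeasurable.sub hvm), fracIncr_sub,
      ENNReal.inv_mul_cancel_left hC ENNReal.ofReal_ne_top]
  refine ⟨φ, hφ, ?_, hae⟩
  have := ((ENNReal.continuous_rpow_const (y := 2⁻¹)).tendsto 0).comp tendsto_sq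
  rw [ENNReal.zero_rpow_of_pos (by norm_num)] at this
  refine this.congr fun n => ?_
  simpa using ENNReal.pow_rpow_inv_natCast two_ne_zero _

lemma HdotApprox.memLp_fracIncr (hs : s ∈ Set.Ioo 0 1) (H : HdotApprox s φ v) :
    MemLp (fracIncr s v) 2 := by
  obtain ⟨n, hn⟩ := (H.tendsto.eventually (gt_mem_nhds one_pos)).exists
  have hφ := (H.isTest n).memLp_fracIncr hs
  have hsub : MemLp (fracIncr s (φ n) - fracIncr s v) 2 :=
    ⟨hφ.1.sub (aestronglyMeasurable_fracIncr s H.aestronglyMeasurable),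
      hn.trans ENNReal.one_lt_top⟩
  simpa only [sub_sub_cancel] using hφ.sub hsub

lemma HdotApprox.comp (hs : s ∈ Set.Ioo 0 1) (H : HdotApprox s φ v) {h : ℝ → ℝ}
    (hh : ContDiff ℝ ∞ h) (h0 : h 0 = 0) {K : NNReal} (hK : LipschitzWith K h) :
    HdotApprox s (fun n x => h (φ n x)) fun x => h (v x) where
  isTest n := (H.isTest n).comp_left hh h0
  ae_tendsto := H.ae_tendsto.mono fun _ hx => (hh.continuous.tendsto _).comp hx
  tendsto := by
    have hφ2 : ∀ n, MemLp (fracIncr s (φ n)) 2 := fun n => (H.isTest n).memLp_fracIncr hs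
    have hv2 := H.memLp_fracIncr hs
    refine tendsto_eLpNorm_of_norm_le_of_tendsto one_le_two ENNReal.ofNat_ne_top
      (G := fun n => (K : ℝ) • fracIncr s (φ n)) (G₀ := (K : ℝ) • fracIncr s v)
      (fun n => (((H.isTest n).comp_left hh h0).memLp_fracIncr hs).1)
      (memLp_fracIncr_comp H.aestronglyMeasurable hv2 hK) (fun n => (hφ2 n).const_smul (K : ℝ))
      (hv2.const_smul (K : ℝ))
      (fun n => Eventually.of_forall (norm_fracIncr_comp_le s hK (φ n))) ?_ ?_
    · simp only [← smul_sub, eLpNorm_const_smul]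
      simpa only [mul_zero] using ENNReal.Tendsto.const_mul H.tendsto (Or.inr enorm_ne_top)
    · exact ae_tendsto_fracIncr s
        (H.ae_tendsto.mono fun _ hx => (hh.continuous.tendsto _).comp hx)

lemma HdotApprox.tendsto_fracForm_self (hs : s ∈ Set.Ioo 0 1) (H : HdotApprox s φ v) :
    Tendsto (fun n => fracForm s (φ n) (φ n)) atTop (𝓝 (fracForm s v v)) :=
  have hφ2 n := (H.isTest n).memLp_fracIncr hs
  have hv2 := H.memLp_fracIncr hs
  (tendsto_integral_mul hφ2 hφ2 hv2 hv2 H.tendsto H.tendsto).const_mul _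

lemma HdotApprox.tendsto_fracForm_left (hs : s ∈ Set.Ioo 0 1) (H : HdotApprox s φ v)
    {u : E d → ℝ} (hu2 : MemLp (fracIncr s u) 2) :
    Tendsto (fun n => fracForm s u (φ n)) atTop (𝓝 (fracForm s u v)) :=
  (tendsto_integral_mul (fun _ => hu2) (fun n => (H.isTest n).memLp_fracIncr hs) hu2
    (H.memLp_fracIncr hs) (by simp) H.tendsto).const_mul _

lemma HdotApprox.fracForm_comp_eq_integral (hs : s ∈ Set.Ioo 0 1) (H : HdotApprox s φ v)
    (hv : MemLp v ⊤) {f : E d → ℝ} (hf : Integrable f) (hvf : HasFracLap s v f)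
    {h : ℝ → ℝ} (hh : ContDiff ℝ ∞ h) (h0 : h 0 = 0) {K : NNReal} (hK : LipschitzWith K h)
    {B : ℝ} (hB : ∀ t, ‖h t‖ ≤ B) :
    fracForm s v (fun x => h (v x)) = ∫ x, f x * h (v x) := by
  have Hh := H.comp hs hh h0 hK
  have hv2 := H.memLp_fracIncr hs
  have tendsto_right : Tendsto (fun n => ∫ x, f x * h (φ n x)) atTop (𝓝 (∫ x, f x * h (v x))) := by
    refine tendsto_integral_of_dominated_convergence (fun x => ‖f x‖ * B)
      (fun n => hf.1.mul (Hh.isTest n).continuous.aestronglyMeasurable)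
      (hf.norm.mul_const B) (fun n => Eventually.of_forall fun x => ?_)
      (Hh.ae_tendsto.mono fun x hx => hx.const_mul _)
    rw [norm_mul]
    exact mul_le_mul_of_nonneg_left (hB _) (norm_nonneg _)
  refine tendsto_nhds_unique (Hh.tendsto_fracForm_left hs hv2) (tendsto_right.congr fun n => ?_)
  rw [← (hvf.2 _ (Hh.isTest n)).2, (Hh.isTest n).integral_mul_fracLap hs hv hv2]

end HdotLimit

lemma half_mem_Ioo_zero_one {s : ℝ} (hs : s ∈ Set.Ioo 0 1) : s / 2 ∈ Set.Ioo 0 1 :=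
  ⟨half_pos hs.1, (half_lt_self hs.1).trans hs.2⟩

section Fourier

open scoped FourierTransform

variable {d : ℕ} {s : ℝ} {u φ : E d → ℝ}

/-- The Fourier transform of a real-valued function. -/
def realFourier (φ : E d → ℝ) : E d → ℂ := 𝓕 fun x => (φ x : ℂ)

lemma IsTest.exists_schwartzMap (hφ : IsTest φ) :
    ∃ f : SchwartzMap (E d) ℂ,
      (∀ x, f x = (φ x : ℂ)) ∧ ((𝓕 f : SchwartzMap (E d) ℂ) : E d → ℂ) = realFourier φ := by
  have hsupp : HasCompactSupport fun x => (φ x : ℂ) := hφ.2.comp_left Complex.ofReal_zero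
  exact ⟨hsupp.toSchwartzMap (Complex.ofRealCLM.contDiff.comp hφ.1), fun _ => rfl, rfl⟩

lemma IsTest.continuous_realFourier (hφ : IsTest φ) : Continuous (realFourier φ) := by
  obtain ⟨f, -, hf⟩ := hφ.exists_schwartzMap
  exact hf ▸ (𝓕 f).continuous

lemma IsTest.memLp_realFourier (hφ : IsTest φ) : MemLp (realFourier φ) 2 := by
  obtain ⟨f, -, hf⟩ := hφ.exists_schwartzMap
  exact hf ▸ (𝓕 f).memLp 2 volume

lemma IsTest.integral_inner_realFourier (hu : IsTest u) (hφ : IsTest φ) :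
    ∫ ξ, inner ℝ (realFourier u ξ) (realFourier φ ξ) = ∫ x, u x * φ x := by
  obtain ⟨f, hf, hf'⟩ := hu.exists_schwartzMap
  obtain ⟨g, hg, hg'⟩ := hφ.exists_schwartzMap
  have integrable_inner : Integrable fun ξ => inner ℂ (realFourier u ξ) (realFourier φ ξ) := by
    exact integrable_inner_of_memLp_two ℂ hu.memLp_realFourier hφ.memLp_realFourier
  have inner_ofReal : ∀ x, inner ℂ (f x) (g x) = ((u x * φ x : ℝ) : ℂ) := fun x => by
    simp [hf, hg, mul_comm]
  have parseval := SchwartzMap.integral_inner_fourier_fourier f g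
  rw [hf', hg', funext inner_ofReal, integral_complex_ofReal] at parseval
  exact (integral_re integrable_inner).trans (congrArg Complex.re parseval)

lemma realFourier_mul_const (φ : E d → ℝ) (c : ℝ) (ξ : E d) :
    realFourier (fun x => φ x * c) ξ = c * realFourier φ ξ := by
  simp only [realFourier, Real.fourier_eq, ← integral_const_mul]
  congr! 2
  simp only [Circle.smul_def, smul_eq_mul, Complex.ofReal_mul]
  ring

lemma IsTest.realFourier_comp_add_right_sub (hφ : IsTest φ) (z ξ : E d) :
    realFourier (fun x => φ (x + z) - φ x) ξ = (𝐞 (inner ℝ z ξ) - 1 : ℂ) * realFourier φ ξ := by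
  have translate : 𝓕 (fun x => (φ (x + z) : ℂ)) ξ = (𝐞 (inner ℝ z ξ) : ℂ) * realFourier φ ξ :=
    congrFun (VectorFourier.fourierIntegral_comp_add_right 𝐞 volume (innerₗ (E d))
      (fun x => (φ x : ℂ)) z) ξ
  rw [sub_mul, one_mul, ← translate]
  simp only [realFourier, Real.fourier_eq]
  rw [← integral_sub
    ((Real.fourierIntegral_convergent_iff ξ).2 (hφ.comp_add_right z).integrable.ofReal)
    ((Real.fourierIntegral_convergent_iff ξ).2 hφ.integrable.ofReal)]
  simp only [Complex.ofReal_sub, smul_sub]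

lemma norm_fourierChar_sub_one_sq (t : ℝ) :
    ‖(𝐞 t - 1 : ℂ)‖ ^ 2 = 2 * (1 - Real.cos (2 * Real.pi * t)) := by
  rw [Real.fourierChar_apply, ← Complex.normSq_eq_norm_sq, Complex.normSq_apply]
  simp only [Complex.sub_re, Complex.sub_im, Complex.one_re, Complex.one_im,
    Complex.exp_ofReal_mul_I_re, Complex.exp_ofReal_mul_I_im]
  linear_combination Real.sin_sq_add_cos_sq (2 * Real.pi * t)

lemma inner_mul_mul_left (a b c : ℂ) : inner ℝ (a * b) (a * c) = ‖a‖ ^ 2 * inner ℝ b c := by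
  rw [Complex.inner, Complex.inner, map_mul, mul_mul_mul_comm, Complex.mul_conj,
    Complex.re_ofReal_mul, Complex.normSq_eq_norm_sq]

/-- The Fourier transform of `fracIncr s φ` in the first variable, as a function of
(frequency, step). -/
def fourierIncr (s : ℝ) (φ : E d → ℝ) (p : E d × E d) : ℂ :=
  realFourier (fun x => fracIncr s φ (x, p.2)) p.1

lemma IsTest.fourierIncr_eq (hφ : IsTest φ) (p : E d × E d) :
    fourierIncr s φ p
      = (√(fracKernel s p.2) * (𝐞 (inner ℝ p.2 p.1) - 1) : ℂ) * realFourier φ p.1 := by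
  rw [fourierIncr, mul_assoc, ← hφ.realFourier_comp_add_right_sub]
  exact realFourier_mul_const (fun x => φ (x + p.2) - φ x) (√(fracKernel s p.2)) p.1

lemma IsTest.fracIncr_slice (hφ : IsTest φ) (z : E d) : IsTest fun x => fracIncr s φ (x, z) :=
  have hdiff := (hφ.comp_add_right z).sub hφ
  ⟨hdiff.1.mul (contDiff_const (c := √(fracKernel s z))), hdiff.2.mul_right⟩

lemma IsTest.measurable_fourierIncr (hφ : IsTest φ) : Measurable (fourierIncr s φ) := by
  have := hφ.continuous_realFourier.measurable
  simp only [funext hφ.fourierIncr_eq]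
  fun_prop

lemma IsTest.inner_fourierIncr (hu : IsTest u) (hφ : IsTest φ) (p : E d × E d) :
    inner ℝ (fourierIncr s u p) (fourierIncr s φ p)
      = 2 * ((1 - Real.cos (inner ℝ ((2 * Real.pi) • p.1) p.2)) * fracKernel s p.2)
        * inner ℝ (realFourier u p.1) (realFourier φ p.1) := by
  rw [hu.fourierIncr_eq, hφ.fourierIncr_eq, inner_mul_mul_left, norm_mul, mul_pow,
    norm_fourierChar_sub_one_sq, real_inner_smul_left, real_inner_comm]
  rw [Complex.norm_real, Real.norm_eq_abs, sq_abs, Real.sq_sqrt (fracKernel_nonneg s p.2)]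
  ring

variable [NeZero d]

lemma IsTest.memLp_fourierIncr (hs : s ∈ Set.Ioo 0 1) (hφ : IsTest φ) :
    MemLp (fourierIncr s φ) 2 := by
  have aestronglyMeasurable : AEStronglyMeasurable (fourierIncr s φ) volume :=
    hφ.measurable_fourierIncr.aestronglyMeasurable
  refine (memLp_two_iff_integrable_sq_norm aestronglyMeasurable).2 ?_
  refine (integrable_prod_iff' (aestronglyMeasurable.norm.pow 2)).2
    ⟨Eventually.of_forall fun z => ?_, ?_⟩
  · exact (memLp_two_iff_integrable_sq_norm
      (hφ.fracIncr_slice z).memLp_realFourier.1).1 (hφ.fracIncr_slice z).memLp_realFourier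
  · refine (hφ.memLp_fracIncr hs).integrable_sq.integral_prod_right.congr
      (Eventually.of_forall fun z => ?_)
    simp only [sq (fracIncr s φ _), Pi.pow_apply, norm_pow, norm_norm]
    rw [← (hφ.fracIncr_slice z).integral_inner_realFourier (hφ.fracIncr_slice z)]
    simp only [real_inner_self_eq_norm_sq, fourierIncr]

lemma fracConst_mul_integral_inner_fourierIncr (hs : s ∈ Set.Ioo 0 1) (hu : IsTest u)
    (hφ : IsTest φ) (ξ : E d) :
    fracConst d s / 2 * ∫ z, inner ℝ (fourierIncr s u (ξ, z)) (fourierIncr s φ (ξ, z))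
      = ‖(2 * Real.pi) • ξ‖ ^ (2 * s) * inner ℝ (realFourier u ξ) (realFourier φ ξ) := by
  simp only [hu.inner_fourierIncr hφ]
  rw [integral_mul_const, integral_const_mul, ← fracConst_mul_integral_one_sub_cos hs]
  ring

lemma integrable_symbol_mul_inner_realFourier (hs : s ∈ Set.Ioo 0 1) (hu : IsTest u)
    (hφ : IsTest φ) : Integrable fun ξ =>
      ‖(2 * Real.pi) • ξ‖ ^ (2 * s) * inner ℝ (realFourier u ξ) (realFourier φ ξ) := by
  simp only [← fracConst_mul_integral_inner_fourierIncr hs hu hφ]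
  exact (integrable_inner_of_memLp_two ℝ (hu.memLp_fourierIncr hs)
    (hφ.memLp_fourierIncr hs)).integral_prod_left.const_mul _

lemma IsTest.fracForm_eq_integral_symbol (hs : s ∈ Set.Ioo 0 1) (hu : IsTest u) (hφ : IsTest φ) :
    fracForm s u φ
      = ∫ ξ, ‖(2 * Real.pi) • ξ‖ ^ (2 * s) * inner ℝ (realFourier u ξ) (realFourier φ ξ) := by
  have integrable_fracIncr : Integrable fun p => fracIncr s u p * fracIncr s φ p :=
    (hu.memLp_fracIncr hs).integrable_mul (hφ.memLp_fracIncr hs)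
  have integrable_fourierIncr :=
    integrable_inner_of_memLp_two ℝ (hu.memLp_fourierIncr hs) (hφ.memLp_fourierIncr hs)
  simp only [← fracConst_mul_integral_inner_fourierIncr hs hu hφ]
  rw [fracForm, integral_const_mul, Measure.volume_eq_prod,
    integral_prod_symm _ integrable_fracIncr, ← integral_prod _ integrable_fourierIncr,
    integral_prod_symm _ integrable_fourierIncr]
  congr! 3 with z
  exact ((hu.fracIncr_slice z).integral_inner_realFourier (hφ.fracIncr_slice z)).symm

/-- Plancherel: both sides of Cauchy–Schwarz are computed in Fourier variables, where
`(-Δ)^{s/2}` is multiplication by `|2πξ|^s`. -/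
lemma IsTest.sq_fracForm_half_le (hs : s ∈ Set.Ioo 0 1) (hu : IsTest u) (hφ : IsTest φ) :
    fracForm (s / 2) u φ ^ 2 ≤ fracForm s u u * ∫ x, φ x ^ 2 := by
  have hs' := half_mem_Ioo_zero_one hs
  let F : E d → ℂ := fun ξ => ((‖(2 * Real.pi) • ξ‖ ^ s : ℝ) : ℂ) * realFourier u ξ
  have inner_F : ∀ ξ, inner ℝ (F ξ) (realFourier φ ξ) = ‖(2 * Real.pi) • ξ‖ ^ (2 * (s / 2)) *
      inner ℝ (realFourier u ξ) (realFourier φ ξ) := fun ξ => by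
    rw [mul_div_cancel₀ s two_ne_zero, ← real_inner_smul_left, Complex.real_smul]
  have norm_F : ∀ ξ, ‖F ξ‖ ^ 2 = ‖(2 * Real.pi) • ξ‖ ^ (2 * s) *
      inner ℝ (realFourier u ξ) (realFourier u ξ) := fun ξ => by
    rw [norm_mul, mul_pow, real_inner_self_eq_norm_sq, Complex.norm_real, Real.norm_eq_abs, sq_abs,
      ← Real.rpow_mul_natCast (norm_nonneg _), Nat.cast_two, mul_comm s]
  have memLp_F : MemLp F 2 := by
    have := hu.continuous_realFourier.measurable
    refine (memLp_two_iff_integrable_sq_norm (by fun_prop)).2 ?_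
    simpa only [norm_F] using integrable_symbol_mul_inner_realFourier hs hu hu
  have cauchy_schwarz := sq_integral_inner_le memLp_F hφ.memLp_realFourier
  simp only [inner_F, norm_F, ← real_inner_self_eq_norm_sq (realFourier φ _)] at cauchy_schwarz
  rw [← hu.fracForm_eq_integral_symbol hs' hφ, ← hu.fracForm_eq_integral_symbol hs hu,
    hφ.integral_inner_realFourier hφ] at cauchy_schwarz
  simpa only [← sq] using cauchy_schwarz

end Fourier

lemma stroock_varopoulos {q a b : ℝ} (hq : 1 < q) (ha : 0 ≤ a) (hb : 0 ≤ b) :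
    4 * (q - 1) / q ^ 2 * (a ^ (q / 2) - b ^ (q / 2)) ^ 2
      ≤ (a - b) * (a ^ (q - 1) - b ^ (q - 1)) := by
  wlog hba : b ≤ a generalizing a b
  · linarith [this hb ha (le_of_not_ge hba)]
  have hq1 : 0 < q - 1 := sub_pos.2 hq
  let F : ℝ → ℝ := fun t => t ^ (q / 2 - 1)
  have integral_F : ∫ t in Set.Ioc b a, F t = (a ^ (q / 2) - b ^ (q / 2)) / (q / 2) := by
    rw [← intervalIntegral.integral_of_le hba, integral_rpow (Or.inl (by linarith)),
      sub_add_cancel]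
  have F_sq : Set.EqOn (fun t => F t ^ 2) (fun t => t ^ (q - 2)) (Set.Ioc b a) := fun t ht => by
    simp only [F]
    rw [← Real.rpow_mul_natCast (hb.trans ht.1.le)]
    congr 1
    push_cast
    ring
  have integral_F_sq : ∫ t in Set.Ioc b a, F t ^ 2 = (a ^ (q - 1) - b ^ (q - 1)) / (q - 1) := by
    rw [setIntegral_congr_fun measurableSet_Ioc F_sq, ← intervalIntegral.integral_of_le hba,
      integral_rpow (Or.inl (by linarith)), show q - 2 + 1 = q - 1 by ring]
  have memLp_F : MemLp F 2 (volume.restrict (Set.Ioc b a)) := by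
    refine (memLp_two_iff_integrable_sq (by fun_prop)).2 ?_
    exact ((intervalIntegral.intervalIntegrable_rpow' (by linarith)).1).congr_fun F_sq.symm
      measurableSet_Ioc
  have cauchy_schwarz := sq_integral_inner_le memLp_F
    (memLp_const (1 : ℝ) : MemLp _ 2 (volume.restrict (Set.Ioc b a)))
  simp only [RCLike.inner_apply, one_mul, Real.norm_eq_abs, sq_abs, conj_trivial, one_pow,
    integral_F, integral_F_sq, setIntegral_const, Real.volume_real_Ioc_of_le hba, smul_eq_mul,
    mul_one] at cauchy_schwarz
  calc 4 * (q - 1) / q ^ 2 * (a ^ (q / 2) - b ^ (q / 2)) ^ 2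
      = (q - 1) * ((a ^ (q / 2) - b ^ (q / 2)) / (q / 2)) ^ 2 := by field_simp; ring
    _ ≤ (q - 1) * ((a ^ (q - 1) - b ^ (q - 1)) / (q - 1) * (a - b)) := by gcongr
    _ = (a - b) * (a ^ (q - 1) - b ^ (q - 1)) := by field_simp

open scoped Manifold in
lemma exists_contDiff_hasCompactSupport_eqOn {V W : Type*} [NormedAddCommGroup V]
    [NormedSpace ℝ V] [FiniteDimensional ℝ V] [NormedAddCommGroup W] [NormedSpace ℝ W]
    {f : V → W} {K U : Set V} (hK : IsCompact K) (hU : IsOpen U) (hKU : K ⊆ U)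
    (hf : ContDiffOn ℝ ∞ f U) :
    ∃ g, ContDiff ℝ ∞ g ∧ HasCompactSupport g ∧ Set.EqOn g f K := by
  obtain ⟨L, hL, hKL, hLU⟩ := exists_compact_between hK hU hKU
  obtain ⟨χ, hχ_one, hχ_zero, -⟩ :=
    exists_contMDiffMap_one_nhds_of_subset_interior 𝓘(ℝ, V) (n := ⊤) hK.isClosed hKL
  have eq_zero : ∀ x ∉ L, χ x • f x = 0 := fun x hx => by rw [hχ_zero x hx, zero_smul]
  refine ⟨fun x => χ x • f x, ?_, HasCompactSupport.intro hL eq_zero, fun x hx => ?_⟩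
  · refine contDiff_of_contDiffOn_union_of_isOpen
      (χ.contMDiff.contDiff.contDiffOn.smul hf)
      ((contDiffOn_const (c := 0)).congr eq_zero) ?_ hU hL.isClosed.isOpen_compl
    exact Set.eq_univ_of_forall fun x => (em (x ∈ L)).imp (fun h => hLU h) id
  · simp only [hχ_one.self_of_nhdsSet x hx, one_smul]

lemma exists_contDiff_eq_shifted_rpow (p : ℝ) {δ M : ℝ} (hδ : 0 < δ) (hM : 0 ≤ M) :
    ∃ h : ℝ → ℝ, ContDiff ℝ ∞ h ∧ HasCompactSupport h ∧ h 0 = 0 ∧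
      ∀ t ∈ Set.Icc 0 M, h t = (t + δ) ^ p - δ ^ p := by
  have contDiffOn : ContDiffOn ℝ ∞ (fun t => (t + δ) ^ p - δ ^ p) (Set.Ioi (-δ)) := fun t ht =>
    (((contDiffAt_id.add contDiffAt_const).rpow_const_of_ne
      (neg_lt_iff_pos_add.1 ht).ne').sub contDiffAt_const).contDiffWithinAt
  obtain ⟨h, hh, hcs, heq⟩ := exists_contDiff_hasCompactSupport_eqOn isCompact_Icc isOpen_Ioi
    (fun t ht => (neg_lt_zero.2 hδ).trans_le ht.1) contDiffOn
  exact ⟨h, hh, hcs, by simp [heq (Set.left_mem_Icc.2 hM)], heq⟩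

lemma exists_inner_eq_of_norm_le {𝕜 V H : Type*} [RCLike 𝕜] [AddCommGroup V] [Module 𝕜 V]
    [NormedAddCommGroup H] [InnerProductSpace 𝕜 H] [CompleteSpace H]
    (J : V →ₗ[𝕜] H) (T : V →ₗ[𝕜] 𝕜) {C : ℝ} (hC : 0 ≤ C) (hT : ∀ x, ‖T x‖ ≤ C * ‖J x‖) :
    ∃ g : H, ‖g‖ ≤ C ∧ ∀ x, inner 𝕜 g (J x) = T x := by
  let L := T.compLeftInverse J
  have L_apply : ∀ x, L ⟨J x, x, rfl⟩ = T x := fun x =>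
    T.compLeftInverse_apply_of_bdd J ⟨C, hT⟩ x (J x) rfl
  have norm_L_le : ‖L‖ ≤ C := by
    refine L.opNorm_le_bound hC ?_
    rintro ⟨_, x, rfl⟩
    exact (L_apply x).symm ▸ hT x
  obtain ⟨Φ, hΦ, norm_Φ⟩ := exists_extension_norm_eq _ L
  refine ⟨(InnerProductSpace.toDual 𝕜 H).symm Φ, ?_, fun x => ?_⟩
  · rwa [LinearIsometryEquiv.norm_map, norm_Φ]
  · rw [InnerProductSpace.toDual_symm_apply, ← L_apply, ← hΦ]

section WeakBound

variable {d : ℕ} {s : ℝ}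

/-- The space of test functions, as a domain for linear functionals. -/
def testFunctions (d : ℕ) : Submodule ℝ (E d → ℝ) where
  carrier := {φ | IsTest φ}
  add_mem' hφ hψ := ⟨hφ.1.add hψ.1, hφ.2.add hψ.2⟩
  zero_mem' := ⟨contDiff_const, HasCompactSupport.zero⟩
  smul_mem' _ _ hφ := ⟨contDiff_const.smul hφ.1, hφ.2.smul_left⟩

/-- The inclusion of the test functions into `L²`. -/
def testFunctionsToL2 (d : ℕ) : testFunctions d →ₗ[ℝ] Lp ℝ 2 (volume : Measure (E d)) where
  toFun φ := (IsTest.memLp φ.2 2).toLp φ.1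
  map_add' _ _ := rfl
  map_smul' _ _ := rfl

lemma fracSecondDiff_add (s : ℝ) (φ ψ : E d → ℝ) :
    fracSecondDiff s (φ + ψ) = fracSecondDiff s φ + fracSecondDiff s ψ := by
  funext p
  simp only [fracSecondDiff, secondDiff, Pi.add_apply]
  ring

lemma fracSecondDiff_smul (s c : ℝ) (φ : E d → ℝ) :
    fracSecondDiff s (c • φ) = c • fracSecondDiff s φ := by
  funext p
  simp only [fracSecondDiff, secondDiff, Pi.smul_apply, smul_eq_mul]
  ring

variable [NeZero d]

/-- The distribution `(-Δ)^s u` of a bounded function `u`. -/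
def fracLapDistribution (hs : s ∈ Set.Ioo 0 1) {u : E d → ℝ} (hu : MemLp u ⊤) :
    testFunctions d →ₗ[ℝ] ℝ where
  toFun φ := ∫ x, u x * fracLap s φ.1 x
  map_add' φ ψ := by
    have hφ : IsTest φ.1 := φ.2
    have hψ : IsTest ψ.1 := ψ.2
    rw [IsTest.integral_mul_fracLap_eq hs (φ + ψ).2 hu, hφ.integral_mul_fracLap_eq hs hu,
      hψ.integral_mul_fracLap_eq hs hu, ← mul_add,
      ← integral_add (hφ.integrable_mul_fracSecondDiff hs hu)
        (hψ.integrable_mul_fracSecondDiff hs hu)]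
    simp only [Submodule.coe_add, fracSecondDiff_add, Pi.add_apply, mul_add]
  map_smul' c φ := by
    have hφ : IsTest φ.1 := φ.2
    rw [IsTest.integral_mul_fracLap_eq hs (c • φ).2 hu, hφ.integral_mul_fracLap_eq hs hu,
      RingHom.id_apply, smul_eq_mul, mul_left_comm, ← integral_const_mul c]
    simp only [Submodule.coe_smul, fracSecondDiff_smul, Pi.smul_apply, smul_eq_mul, mul_left_comm]

/-- The bound `‖(-Δ)^s u‖² ≤ A` in `L²`, in weak form: no representative of the distribution
`(-Δ)^s u` is required. -/
structure HasFracLapBound (s : ℝ) (u : E d → ℝ) (A : ℝ) : Prop where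
  nonneg : 0 ≤ A
  sq_integral_le : ∀ φ, IsTest φ → (∫ x, u x * fracLap s φ x) ^ 2 ≤ A * ∫ x, φ x ^ 2

namespace HasFracLapBound

variable {u w : E d → ℝ} {A B : ℝ}

lemma mono (h : HasFracLapBound s u A) (hAB : A ≤ B) : HasFracLapBound s u B where
  nonneg := h.nonneg.trans hAB
  sq_integral_le φ hφ := (h.sq_integral_le φ hφ).trans
    (mul_le_mul_of_nonneg_right hAB (integral_nonneg fun _ => sq_nonneg _))

lemma congr_ae (h : HasFracLapBound s u A) (huw : u =ᵐ[volume] w) : HasFracLapBound s w A where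
  nonneg := h.nonneg
  sq_integral_le φ hφ := by
    have huw' : (fun x => u x * fracLap s φ x) =ᵐ[volume] fun x => w x * fracLap s φ x :=
      huw.mul (ae_eq_refl (fracLap s φ))
    exact integral_congr_ae huw' ▸ h.sq_integral_le φ hφ

lemma of_tendsto {ι : Type*} {l : Filter ι} [l.NeBot] {F : ι → E d → ℝ} {a : ι → ℝ}
    (h : ∀ᶠ i in l, HasFracLapBound s (F i) (a i)) (ha : Tendsto a l (𝓝 A))
    (hF : ∀ φ, IsTest φ → Tendsto (fun i => ∫ x, F i x * fracLap s φ x) l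
      (𝓝 (∫ x, u x * fracLap s φ x))) : HasFracLapBound s u A where
  nonneg := ge_of_tendsto ha (h.mono fun _ hi => hi.nonneg)
  sq_integral_le φ hφ := le_of_tendsto_of_tendsto ((hF φ hφ).pow 2) (ha.mul_const _)
    (h.mono fun _ hi => hi.sq_integral_le φ hφ)

lemma exists_hasFracLap (hs : s ∈ Set.Ioo 0 1) (hu : MemLp u ⊤) (h : HasFracLapBound s u A) :
    ∃ g, MemLp g 2 ∧ HasFracLap s u g ∧ ∫ x, |g x| ^ 2 ≤ A := by
  have norm_toL2_sq : ∀ φ, ‖testFunctionsToL2 d φ‖ ^ 2 = ∫ x, φ.1 x ^ 2 := fun φ => by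
    have hφ : MemLp φ.1 2 := IsTest.memLp φ.2 2
    have norm_sq := inner_toLp_toLp hφ hφ
    simp only [real_inner_self_eq_norm_sq, Real.norm_eq_abs, sq_abs] at norm_sq
    exact norm_sq
  obtain ⟨g, norm_g, hg⟩ := exists_inner_eq_of_norm_le (testFunctionsToL2 d)
    (fracLapDistribution hs hu) (Real.sqrt_nonneg A) fun φ => by
      rw [← Real.sqrt_sq (norm_nonneg (testFunctionsToL2 d φ)), ← Real.sqrt_mul h.nonneg,
        norm_toL2_sq]
      exact Real.abs_le_sqrt (h.sq_integral_le φ.1 φ.2)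
  have memLp_g : MemLp g 2 := Lp.memLp g
  have inner_g : ∀ {φ : E d → ℝ} (hφ : MemLp φ 2),
      inner ℝ g (hφ.toLp φ) = ∫ x, inner ℝ (g x) (φ x) := fun hφ => by
    simpa only [Lp.toLp_coeFn] using inner_toLp_toLp memLp_g hφ
  refine ⟨g, memLp_g, ⟨memLp_g.locallyIntegrable one_le_two, fun φ hφ =>
    ⟨hφ.integrable_mul_fracLap hs hu, ?_⟩⟩, ?_⟩
  · refine (hg ⟨φ, hφ⟩).symm.trans ((inner_g (hφ.memLp 2)).trans ?_)
    simp only [RCLike.inner_apply, conj_trivial, mul_comm]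
  · have norm_g_sq : ‖g‖ ^ 2 = ∫ x, |g x| ^ 2 := by
      have := inner_g memLp_g
      simpa only [Lp.toLp_coeFn, real_inner_self_eq_norm_sq, Real.norm_eq_abs] using this
    exact norm_g_sq ▸ (Real.le_sqrt (norm_nonneg g) h.nonneg).1 norm_g

end HasFracLapBound

lemma IsTest.hasFracLapBound_half {u : E d → ℝ} (hs : s ∈ Set.Ioo 0 1) (hu : IsTest u) :
    HasFracLapBound (s / 2) u (fracForm s u u) where
  nonneg := mul_nonneg (half_pos (fracConst_pos hs)).le
    (integral_nonneg fun p => mul_self_nonneg (fracIncr s u p))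
  sq_integral_le φ hφ := by
    have hs' := half_mem_Ioo_zero_one hs
    rw [hφ.integral_mul_fracLap hs' (hu.memLp ⊤) (hu.memLp_fracIncr hs')]
    exact hu.sq_fracForm_half_le hs hφ

lemma HdotApprox.hasFracLapBound_half {ψ : ℕ → E d → ℝ} {v : E d → ℝ} (hs : s ∈ Set.Ioo 0 1)
    (H : HdotApprox s ψ v) {B : ℝ} (hB : ∀ n x, ‖ψ n x‖ ≤ B) :
    HasFracLapBound (s / 2) v (fracForm s v v) := by
  have hs' := half_mem_Ioo_zero_one hs
  refine HasFracLapBound.of_tendsto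
    (Eventually.of_forall fun n => (H.isTest n).hasFracLapBound_half hs)
    (H.tendsto_fracForm_self hs) fun φ hφ => ?_
  have integrable_fracLap := hφ.integrable_fracLap hs'
  refine tendsto_integral_of_dominated_convergence (fun x => B * ‖fracLap (s / 2) φ x‖)
    (fun n => (H.isTest n).continuous.aestronglyMeasurable.mul integrable_fracLap.1)
    (integrable_fracLap.norm.const_mul B) (fun n => Eventually.of_forall fun x => ?_)
    (H.ae_tendsto.mono fun x hx => hx.mul_const _)
  rw [norm_mul]
  exact mul_le_mul_of_nonneg_right (hB n x) (norm_nonneg _)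

end WeakBound

section Rpow

variable {α : Type*} [MeasurableSpace α] {μ : Measure α} {v F : α → ℝ} {p : ℝ}

lemma abs_shifted_rpow_le {t δ M : ℝ} (hp : 0 ≤ p) (hδ : δ ∈ Set.Icc 0 1)
    (ht : t ∈ Set.Icc 0 M) : |(t + δ) ^ p - δ ^ p| ≤ (M + 1) ^ p := by
  have lower : δ ^ p ≤ (t + δ) ^ p :=
    Real.rpow_le_rpow hδ.1 (le_add_of_nonneg_left ht.1) hp
  have upper : (t + δ) ^ p ≤ (M + 1) ^ p :=
    Real.rpow_le_rpow (add_nonneg ht.1 hδ.1) (add_le_add ht.2 hδ.2) hp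
  rw [abs_of_nonneg (sub_nonneg.2 lower)]
  linarith [Real.rpow_nonneg hδ.1 p]

lemma tendsto_integral_shifted_rpow (hv : AEStronglyMeasurable v μ) {M : ℝ}
    (hvM : ∀ᵐ a ∂μ, v a ∈ Set.Icc 0 M) (hF : Integrable F μ) (hp : 0 < p) :
    Tendsto (fun δ : ℝ => ∫ a, ((v a + δ) ^ p - δ ^ p) * F a ∂μ) (𝓝[>] 0)
      (𝓝 (∫ a, v a ^ p * F a ∂μ)) := by
  have continuous_rpow := Real.continuous_rpow_const hp.le
  refine tendsto_integral_filter_of_dominated_convergence (fun a => (M + 1) ^ p * ‖F a‖)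
    (Eventually.of_forall fun δ => ?_) ?_ (hF.norm.const_mul _) (Eventually.of_forall fun a => ?_)
  · exact ((continuous_rpow.comp_aestronglyMeasurable (hv.add_const δ)).sub
      aestronglyMeasurable_const).mul hF.1
  · filter_upwards [Ioo_mem_nhdsGT one_pos] with δ hδ
    filter_upwards [hvM] with a ha
    rw [norm_mul]
    exact mul_le_mul_of_nonneg_right
      (abs_shifted_rpow_le hp.le (Set.Ioo_subset_Icc_self hδ) ha) (norm_nonneg _)
  · have continuous_shift : Continuous fun δ : ℝ => ((v a + δ) ^ p - δ ^ p) * F a :=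
      ((continuous_rpow.comp (continuous_const.add continuous_id)).sub continuous_rpow).mul
        continuous_const
    have := continuous_shift.tendsto 0
    rw [add_zero, Real.zero_rpow hp.ne', sub_zero] at this
    exact this.mono_left nhdsWithin_le_nhds

lemma memLp_top_rpow_const (hv : MemLp v ⊤ μ) (hp : 0 ≤ p) : MemLp (fun a => v a ^ p) ⊤ μ := by
  obtain ⟨M, -, hM⟩ := exists_ae_norm_le_of_memLp_top hv
  refine memLp_top_of_bound ((Real.continuous_rpow_const hp).comp_aestronglyMeasurable hv.1)
    (M ^ p) (hM.mono fun a ha => ?_)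
  exact (Real.abs_rpow_le_abs_rpow _ _).trans (Real.rpow_le_rpow (abs_nonneg _) ha hp)

end Rpow

section Truncation

variable {d : ℕ} [NeZero d] {s : ℝ} {φ : ℕ → E d → ℝ} {v f : E d → ℝ}

lemma mul_fracForm_comp_self_le_fracForm_comp {S : Set ℝ} {h k : ℝ → ℝ} {c : ℝ}
    (hs : s ∈ Set.Ioo 0 1) (hvS : ∀ᵐ x, v x ∈ S)
    (hkh : ∀ a ∈ S, ∀ b ∈ S, c * (k a - k b) ^ 2 ≤ (a - b) * (h a - h b))
    (hv : MemLp (fracIncr s v) 2) (hk : MemLp (fracIncr s fun x => k (v x)) 2)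
    (hh : MemLp (fracIncr s fun x => h (v x)) 2) :
    c * fracForm s (fun x => k (v x)) (fun x => k (v x)) ≤ fracForm s v fun x => h (v x) := by
  rw [fracForm, mul_left_comm, ← integral_const_mul]
  refine mul_le_mul_of_nonneg_left (integral_mono_ae ((hk.integrable_mul hk).const_mul c)
    (hv.integrable_mul hh) ?_) (half_pos (fracConst_pos hs)).le
  filter_upwards [Measure.quasiMeasurePreserving_fst.ae hvS,
    (quasiMeasurePreserving_add volume volume).ae hvS] with p hfst hadd
  rw [fracIncr_mul_fracIncr, fracIncr_mul_fracIncr, ← mul_assoc, ← sq]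
  exact mul_le_mul_of_nonneg_right (hkh _ hadd _ hfst) (fracKernel_nonneg s p.2)

lemma HdotApprox.hasFracLapBound_shifted_rpow (hs : s ∈ Set.Ioo 0 1) (H : HdotApprox s φ v)
    (hv : MemLp v ⊤) (hv0 : ∀ᵐ x, 0 ≤ v x) (hf : Integrable f) (hvf : HasFracLap s v f)
    {q δ : ℝ} (hq : 1 < q) (hδ : 0 < δ) :
    HasFracLapBound (s / 2) (fun x => (v x + δ) ^ (q / 2) - δ ^ (q / 2))
      ((∫ x, ((v x + δ) ^ (q - 1) - δ ^ (q - 1)) * f x) / (4 * (q - 1) / q ^ 2)) := by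
  obtain ⟨M, hM0, hM⟩ := exists_ae_norm_le_of_memLp_top hv
  have hvM : ∀ᵐ x, v x ∈ Set.Icc 0 M :=
    hv0.and (hM.mono fun _ hx => (Real.le_norm_self _).trans hx)
  obtain ⟨h, hh, h_supp, h0, h_eq⟩ := exists_contDiff_eq_shifted_rpow (q - 1) hδ hM0
  obtain ⟨k, hk, k_supp, k0, k_eq⟩ := exists_contDiff_eq_shifted_rpow (q / 2) hδ hM0
  obtain ⟨Kh, hKh⟩ := hh.lipschitzWith_of_hasCompactSupport h_supp (by simp)
  obtain ⟨Kk, hKk⟩ := hk.lipschitzWith_of_hasCompactSupport k_supp (by simp)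
  obtain ⟨Bh, hBh⟩ := h_supp.exists_bound_of_continuous hh.continuous
  obtain ⟨Bk, hBk⟩ := k_supp.exists_bound_of_continuous hk.continuous
  have Hk := H.comp hs hk k0 hKk
  have stroock : ∀ a ∈ Set.Icc 0 M, ∀ b ∈ Set.Icc 0 M,
      4 * (q - 1) / q ^ 2 * (k a - k b) ^ 2 ≤ (a - b) * (h a - h b) := fun a ha b hb => by
    simpa only [k_eq a ha, k_eq b hb, h_eq a ha, h_eq b hb, sub_sub_sub_cancel_right,
      add_sub_add_right_eq_sub] using
      stroock_varopoulos hq (add_nonneg ha.1 hδ.le) (add_nonneg hb.1 hδ.le)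
  have energy_le := mul_fracForm_comp_self_le_fracForm_comp hs hvM stroock (H.memLp_fracIncr hs)
    (Hk.memLp_fracIncr hs) ((H.comp hs hh h0 hKh).memLp_fracIncr hs)
  have weak_eq : fracForm s v (fun x => h (v x))
      = ∫ x, ((v x + δ) ^ (q - 1) - δ ^ (q - 1)) * f x := by
    rw [H.fracForm_comp_eq_integral hs hv hf hvf hh h0 hKh hBh]
    exact integral_congr_ae (hvM.mono fun x hx => by simp only [h_eq _ hx, mul_comm])
  have hc : 0 < 4 * (q - 1) / q ^ 2 := div_pos (by linarith) (by positivity)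
  rw [weak_eq, mul_comm, ← le_div_iff₀ hc] at energy_le
  exact ((Hk.hasFracLapBound_half hs fun n x => hBk _).mono energy_le).congr_ae
    (hvM.mono fun x hx => k_eq _ hx)

lemma HdotApprox.hasFracLapBound_rpow (hs : s ∈ Set.Ioo 0 1) (H : HdotApprox s φ v)
    (hv : MemLp v ⊤) (hv0 : ∀ᵐ x, 0 ≤ v x) (hf : Integrable f) (hvf : HasFracLap s v f)
    {q : ℝ} (hq : 1 < q) :
    HasFracLapBound (s / 2) (fun x => v x ^ (q / 2))
      ((∫ x, v x ^ (q - 1) * f x) / (4 * (q - 1) / q ^ 2)) := by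
  obtain ⟨M, -, hM⟩ := exists_ae_norm_le_of_memLp_top hv
  have hvM : ∀ᵐ x, v x ∈ Set.Icc 0 M :=
    hv0.and (hM.mono fun _ hx => (Real.le_norm_self _).trans hx)
  refine HasFracLapBound.of_tendsto (l := 𝓝[>] 0) (eventually_mem_of_tendsto_nhdsWithin
    tendsto_id |>.mono fun δ hδ => H.hasFracLapBound_shifted_rpow hs hv hv0 hf hvf hq hδ)
    ((tendsto_integral_shifted_rpow hv.1 hvM hf (sub_pos.2 hq)).div_const _) fun φ hφ => ?_
  exact tendsto_integral_shifted_rpow hv.1 hvM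
    (hφ.integrable_fracLap (half_mem_Ioo_zero_one hs)) (by linarith)

end Truncation

end FracLap

end

theorem lemma4p3_general {d : ℕ} [NeZero d] {s : ℝ} (hs0 : 0 < s) (hs1 : s < 1)
    (v : FracLap.E d → ℝ) (hv0 : ∀ᵐ x : FracLap.E d, 0 ≤ v x)
    (hvb : MemLp v ∞ (volume : Measure (FracLap.E d)))
    (hvH : FracLap.MemHdot s v)
    (f : FracLap.E d → ℝ) (hf : Integrable f (volume : Measure (FracLap.E d)))
    (hvf : FracLap.HasFracLap s v f)
    (q : ℝ) (hq : 1 < q) :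
    Integrable (fun x => v x ^ (q - 1) * f x) (volume : Measure (FracLap.E d)) ∧
    ∃ g : FracLap.E d → ℝ, MemLp g 2 (volume : Measure (FracLap.E d)) ∧
      FracLap.HasFracLap (s / 2) (fun x => v x ^ (q / 2)) g ∧
      4 * (q - 1) / q ^ 2 * ∫ x, |g x| ^ 2 ≤ ∫ x, v x ^ (q - 1) * f x := by
  have hs : s ∈ Set.Ioo 0 1 := ⟨hs0, hs1⟩
  have hc : 0 < 4 * (q - 1) / q ^ 2 := div_pos (by linarith) (by positivity)
  refine ⟨hf.mul_of_top_right (FracLap.memLp_top_rpow_const hvb (by linarith)), ?_⟩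
  obtain ⟨φ, H⟩ := hvH.exists_hdotApprox hs
  obtain ⟨g, memLp_g, hasFracLap_g, integral_le⟩ :=
    (H.hasFracLapBound_rpow hs hvb hv0 hf hvf hq).exists_hasFracLap
      (FracLap.half_mem_Ioo_zero_one hs) (FracLap.memLp_top_rpow_const hvb (by linarith))
  exact ⟨g, memLp_g, hasFracLap_g, by rwa [mul_comm, ← le_div_iff₀ hc]⟩

theorem lemma4p3 {d : ℕ} [NeZero d] {s : ℝ} (hs0 : 0 < s) (hs1 : s < 1)
    (hd : 2 * s < (d : ℝ))
    (v : FracLap.E d → ℝ) (hv0 : ∀ᵐ x : FracLap.E d, 0 ≤ v x)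
    (hvb : MemLp v ∞ (volume : Measure (FracLap.E d)))
    (hvH : FracLap.MemHdot s v)
    (f : FracLap.E d → ℝ) (hf : Integrable f (volume : Measure (FracLap.E d)))
    (hvf : FracLap.HasFracLap s v f)
    (q : ℝ) (hq : 1 < q) :
    Integrable (fun x => v x ^ (q - 1) * f x) (volume : Measure (FracLap.E d)) ∧
    ∃ g : FracLap.E d → ℝ, MemLp g 2 (volume : Measure (FracLap.E d)) ∧
      FracLap.HasFracLap (s / 2) (fun x => v x ^ (q / 2)) g ∧
      4 * (q - 1) / q ^ 2 * ∫ x, |g x| ^ 2 ≤ ∫ x, v x ^ (q - 1) * f x :=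
  lemma4p3_general hs0 hs1 v hv0 hvb hvH f hf hvf q hq
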